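/- Let $n\ge 1$ and let $W_1,\dots,W_{n^2}$ be linearly independent density matrices on $\mathbb{C}^{n}$ (positive semidefinite, trace one), regarded as a classical-quantum channel $W$ with input alphabet $\mathcal{X}=\{1,\dots,n^2\}$. Write $H(\rho)=-\operatorname{Tr}\rho\log\rho$ for the von Neumann entropy, $D(\rho\|\sigma)=\operatorname{Tr}\rho(\log\rho-\log\sigma)$ for the quantum relative entropy (equal to $+\infty$ if $\ker\sigma\not\subset\ker\rho$), and $$C_q(W)=\max_{P}\sum_{x\in\mathcal{X}}P(x)\,D\Big(W_x\Big\|\sum_{x'\in\mathcal{X}}P(x')W_{x'}\Big),$$ where $P$ runs over the probability distributions on $\mathcal{X}$ (and $0\cdot\infty=0$). Let $A_1,\dots,A_{n^2-1}$ be linearly independent Hermitian matrices on $\mathbb{C}^n$ with $\operatorname{Tr}W_{n^2}A_j=0$ for all $j$. For $\theta\in\mathbb{R}^{n^2-1}$ put $$\phi(\theta)=\log\operatorname{Tr}\exp\Big(\sum_{j=1}^{n^2-1}\theta^jA_j\Big),\qquad \rho_\theta=\exp\Big(\sum_{j=1}^{n^2-1}\theta^jA_j-\phi(\theta)I\Big).$$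 Suppose that $\theta$ satisfies $$\sum_{j=1}^{n^2-1}\operatorname{Tr}(W_iA_j)\,\theta^j=-H(W_i)+H(W_{n^2})\qquad(i=1,\dots,n^2).$$ Then $\rho_\theta$ is a density matrix and $$D(W_x\|\rho_\theta)=\phi(\theta)-H(W_{n^2})\qquad\text{for every }x\in\mathcal{X}.$$ Moreover, there is exactly one function $\hat Q_{X,*}:\mathcal{X}\to\mathbb{R}$ with $\sum_{x\in\mathcal{X}}\hat Q_{X,*}(x)W_x=\rho_\theta$. If $\hat Q_{X,*}(x)\ge 0$ for every $x\in\mathcal{X}$, then $\hat Q_{X,*}$ is a probability distribution that attains the maximum in the definition of $C_q(W)$, and $$C_q(W)=\phi(\theta)-H(W_{n^2}).$$ -/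

import Mathlib

namespace CQ

open Matrix
open scoped ComplexOrder

noncomputable section

variable {d : Type*} [Fintype d] [DecidableEq d]

/-- A density matrix on `ℂ^d`: positive semidefinite with unit trace. -/
def IsDensityMatrix (ρ : Matrix d d ℂ) : Prop :=
  ρ.PosSemidef ∧ ρ.trace = 1

/-- The logarithm (base `e`) of a Hermitian matrix by functional calculus. As `Real.log 0 = 0`, it
vanishes on the kernel, which is the convention `0 log 0 = 0` in the traces below. -/
def matLog (ρ : Matrix d d ℂ) : Matrix d d ℂ :=
  cfc Real.log ρ

/-- The von Neumann entropy `H(ρ) = -Tr ρ log ρ`. -/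
def entropy (ρ : Matrix d d ℂ) : ℝ :=
  -(ρ * matLog ρ).trace.re

open scoped Classical in
/-- The quantum relative entropy `D(ρ‖σ) = Tr ρ (log ρ - log σ)`, equal to `+∞` when the kernel of
`σ` is not contained in the kernel of `ρ`. -/
def relEntropy (ρ σ : Matrix d d ℂ) : EReal :=
  if ∀ v : d → ℂ, σ *ᵥ v = 0 → ρ *ᵥ v = 0 then
    (((ρ * (matLog ρ - matLog σ)).trace.re : ℝ) : EReal)
  else ⊤

/-- The output matrix `∑ x, P x W_x`. -/
def output {X : Type*} [Fintype X] (W : X → Matrix d d ℂ) (P : X → ℝ) : Matrix d d ℂ :=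
  ∑ x, P x • W x

/-- `∑ x, P x D(W_x ‖ ∑ x', P x' W_x')`; in `EReal`, `0 * ⊤ = 0`. -/
def holevoInformation {X : Type*} [Fintype X] (W : X → Matrix d d ℂ) (P : X → ℝ) : EReal :=
  ∑ x, (P x : EReal) * relEntropy (W x) (output W P)

/-- The capacity of the classical-quantum channel `W`: the supremum, over the probability
distributions `P` on the input alphabet, of `holevoInformation W P`. -/
def capacity {X : Type*} [Fintype X] (W : X → Matrix d d ℂ) : EReal :=
  sSup (holevoInformation W '' stdSimplex ℝ X)

variable {J : Type*} [Fintype J]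

/-- `φ(θ) = log Tr exp (∑ j, θ j A_j)`. -/
def phi (A : J → Matrix d d ℂ) (θ : J → ℝ) : ℝ :=
  Real.log (NormedSpace.exp (∑ j, θ j • A j)).trace.re

/-- The Gibbs state `ρ_θ = exp (∑ j, θ j A_j - φ(θ))`. -/
def gibbs (A : J → Matrix d d ℂ) (θ : J → ℝ) : Matrix d d ℂ :=
  NormedSpace.exp (∑ j, θ j • A j - phi A θ • (1 : Matrix d d ℂ))

/-- The last element of the input alphabet `{1, …, n²}`. -/
def lastInput (n : ℕ) (hn : 0 < n) : Fin (n ^ 2) :=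
  ⟨n ^ 2 - 1, Nat.sub_lt (pow_pos hn 2) one_pos⟩

end

end CQ

/-!
The state `ρ_θ` is positive definite with `log ρ_θ = ∑ j, θ j A_j - φ(θ)`, so `D(W_x‖ρ_θ)` is affine
in the moments `Tr W_x A_j`, and the equations for `θ` say exactly that it does not depend on `x`.
For every distribution `P` with output state `W_P`, Donald's identity
`∑ x, P x D(W_x‖σ) = ∑ x, P x D(W_x‖W_P) + D(W_P‖σ)` and Klein's inequality `0 ≤ D(W_P‖σ)` bound the
Holevo information of `P` by the common value of `D(W_x‖σ)` at `σ = ρ_θ`. A distribution with output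
`ρ_θ` attains this bound, and the coefficients of `ρ_θ` exist because linearly independent Hermitian
matrices are also independent over `ℂ`, so that `n²` of them form a real basis of the Hermitian
matrices.
-/

namespace CQ

open Matrix
open scoped ComplexOrder

section SelfAdjoint

open scoped ComplexStarModule

variable {E X : Type*} [AddCommGroup E] [Module ℂ E] [StarAddMonoid E] [StarModule ℂ E]
  {a : X → E}

lemma coe_realPart_sum_smul (ha : ∀ x, IsSelfAdjoint (a x)) (s : Finset X) (c : X → ℂ) :
    (ℜ (∑ x ∈ s, c x • a x) : E) = ∑ x ∈ s, (c x).re • a x := by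
  simp [realPart_smul, (ha _).imaginaryPart, (ha _).coe_realPart]

lemma coe_imaginaryPart_sum_smul (ha : ∀ x, IsSelfAdjoint (a x)) (s : Finset X) (c : X → ℂ) :
    (ℑ (∑ x ∈ s, c x • a x) : E) = ∑ x ∈ s, (c x).im • a x := by
  simp [imaginaryPart_smul, (ha _).imaginaryPart, (ha _).coe_realPart]

lemma linearIndependent_complex_of_isSelfAdjoint (ha : ∀ x, IsSelfAdjoint (a x))
    (hind : LinearIndependent ℝ a) : LinearIndependent ℂ a := by
  rw [linearIndependent_iff'] at hind ⊢
  intro s c hc x hx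
  refine Complex.ext (hind s (fun x => (c x).re) ?_ x hx) (hind s (fun x => (c x).im) ?_ x hx)
  · rw [← coe_realPart_sum_smul ha, hc, map_zero, ZeroMemClass.coe_zero]
  · rw [← coe_imaginaryPart_sum_smul ha, hc, map_zero, ZeroMemClass.coe_zero]

lemma existsUnique_sum_smul_eq_of_isSelfAdjoint [Fintype X] [FiniteDimensional ℂ E]
    (ha : ∀ x, IsSelfAdjoint (a x)) (hind : LinearIndependent ℝ a)
    (hcard : Fintype.card X = Module.finrank ℂ E) {b : E} (hb : IsSelfAdjoint b) :
    ∃! c : X → ℝ, ∑ x, c x • a x = b := by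
  have hspan := (linearIndependent_complex_of_isSelfAdjoint ha hind).span_eq_top_of_card_eq_finrank'
    hcard
  have hmem : b ∈ Submodule.span ℂ (Set.range a) := hspan ▸ Submodule.mem_top
  obtain ⟨c, rfl⟩ := (Submodule.mem_span_range_iff_exists_fun ℂ).mp hmem
  have hc : ∑ x, (c x).re • a x = ∑ x, c x • a x := by
    rw [← coe_realPart_sum_smul ha, hb.coe_realPart]
  exact ⟨_, hc, fun c' hc' => hind.fintypeLinearCombination_injective (hc'.trans hc.symm)⟩

end SelfAdjoint

section Klein

variable {𝕜 d : Type*} [RCLike 𝕜] [Fintype d] [DecidableEq d]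

lemma trace_diagonal_mul_mul_diagonal_mul_conjTranspose (a b : d → ℝ) (M : Matrix d d 𝕜) :
    (diagonal (fun i => (a i : 𝕜)) * M * diagonal (fun j => (b j : 𝕜)) * Mᴴ).trace =
      ((∑ i, ∑ j, a i * b j * RCLike.normSq (M i j) : ℝ) : 𝕜) := by
  simp only [trace, diag_apply, mul_apply (N := Mᴴ), mul_diagonal, diagonal_mul,
    conjTranspose_apply, RCLike.star_def, RCLike.normSq_eq_def']
  push_cast
  refine Finset.sum_congr rfl fun i _ => Finset.sum_congr rfl fun j _ => ?_
  linear_combination (a i : 𝕜) * b j * RCLike.mul_conj (M i j)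

/-- The weight `|⟨u_i, v_j⟩|²` of the `i`-th vector of the eigenbasis of `ρ` against the `j`-th
vector of the eigenbasis of `σ`; it expresses traces of products of functions of `ρ` and of `σ`. -/
noncomputable def eigenvectorOverlap {ρ σ : Matrix d d 𝕜} (hρ : ρ.IsHermitian) (hσ : σ.IsHermitian)
    (i j : d) : ℝ :=
  RCLike.normSq
    ((star (hρ.eigenvectorUnitary : Matrix d d 𝕜) * (hσ.eigenvectorUnitary : Matrix d d 𝕜)) i j)

lemma trace_cfc_mul_cfc {ρ σ : Matrix d d 𝕜} (hρ : ρ.IsHermitian) (hσ : σ.IsHermitian)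
    (f g : ℝ → ℝ) :
    (cfc f ρ * cfc g σ).trace =
      ((∑ i, ∑ j, f (hρ.eigenvalues i) * g (hσ.eigenvalues j) * eigenvectorOverlap hρ hσ i j : ℝ) :
        𝕜) := by
  unfold eigenvectorOverlap
  rw [hρ.cfc_eq, hσ.cfc_eq, ← trace_diagonal_mul_mul_diagonal_mul_conjTranspose,
    IsHermitian.cfc, IsHermitian.cfc, Unitary.conjStarAlgAut_apply, Unitary.conjStarAlgAut_apply,
    mul_assoc, mul_assoc, trace_mul_comm, conjTranspose_mul, star_eq_conjTranspose,
    conjTranspose_conjTranspose]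
  simp only [mul_assoc, star_eq_conjTranspose]
  rfl

lemma re_sum_trace_cfc_mul_cfc_nonneg {ι : Type*} [Fintype ι] {ρ σ : Matrix d d 𝕜}
    (hρ : ρ.IsHermitian) (hσ : σ.IsHermitian) {f g : ι → ℝ → ℝ}
    (hfg : ∀ i j, 0 ≤ ∑ k, f k (hρ.eigenvalues i) * g k (hσ.eigenvalues j)) :
    0 ≤ RCLike.re (∑ k, (cfc (f k) ρ * cfc (g k) σ).trace) := by
  simp only [trace_cfc_mul_cfc hρ hσ, ← RCLike.ofReal_sum, RCLike.ofReal_re]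
  rw [Finset.sum_comm]
  refine Finset.sum_nonneg fun i _ => ?_
  rw [Finset.sum_comm]
  refine Finset.sum_nonneg fun j _ => ?_
  rw [← Finset.sum_mul]
  exact mul_nonneg (hfg i j) (RCLike.normSq_nonneg _)

lemma sub_le_mul_log_sub_log {s r : ℝ} (hs : 0 ≤ s) (hr : 0 < r) :
    s - r ≤ s * (Real.log s - Real.log r) := by
  rcases hs.eq_or_lt with rfl | hs
  · simpa using hr.le
  · calc s - r = s * (1 - (s / r)⁻¹) := by field_simp
      _ ≤ s * Real.log (s / r) := by gcongr; exact Real.one_sub_inv_le_log_of_pos (div_pos hs hr)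
      _ = s * (Real.log s - Real.log r) := by rw [Real.log_div hs.ne' hr.ne']

end Klein

section RelEntropy

variable {d : Type*} [Fintype d] [DecidableEq d]

/-- The trace `Tr ρ (log ρ - log σ)`, which is the value of `relEntropy ρ σ` when `ker σ ⊆ ker ρ`.
Working with it keeps identities between relative entropies in `ℝ`. -/
noncomputable def relEntropyReal (ρ σ : Matrix d d ℂ) : ℝ :=
  (ρ * (matLog ρ - matLog σ)).trace.re

lemma relEntropy_of_ker_le {ρ σ : Matrix d d ℂ} (h : ∀ v : d → ℂ, σ *ᵥ v = 0 → ρ *ᵥ v = 0) :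
    relEntropy ρ σ = (relEntropyReal ρ σ : EReal) :=
  if_pos h

lemma relEntropy_of_posDef (ρ : Matrix d d ℂ) {σ : Matrix d d ℂ} (hσ : σ.PosDef) :
    relEntropy ρ σ = (relEntropyReal ρ σ : EReal) := by
  refine relEntropy_of_ker_le fun v hv => ?_
  have hv0 : v = 0 := mulVec_injective_iff_isUnit.mpr hσ.isUnit (by rw [hv, mulVec_zero])
  rw [hv0, mulVec_zero]

lemma trace_sub_trace_le_relEntropyReal {ρ σ : Matrix d d ℂ} (hρ : ρ.PosSemidef)
    (hσ : σ.PosDef) : ρ.trace.re - σ.trace.re ≤ relEntropyReal ρ σ := by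
  have hρ' : IsSelfAdjoint ρ := hρ.1
  have hσ' : IsSelfAdjoint σ := hσ.1
  have hcont (f : ℝ → ℝ) : ContinuousOn f (spectrum ℝ ρ) := finite_real_spectrum.continuousOn f
  have hentropy : cfc (fun s => s * Real.log s) ρ = ρ * cfc Real.log ρ := by
    rw [cfc_mul _ _ ρ (hcont _) (hcont _), cfc_id' ℝ ρ]
  have hneg : cfc (fun s : ℝ => -s) ρ = -ρ := by rw [cfc_neg (R := ℝ) (fun s => s) ρ, cfc_id' ℝ ρ]
  -- The sum of products `∑ k, f k s * g k r` is `s log s - s log r - s + r`.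
  have hnonneg := re_sum_trace_cfc_mul_cfc_nonneg hρ.1 hσ.1
    (f := ![fun s => s * Real.log s, fun s => -s, fun s => -s, fun _ => 1])
    (g := ![fun _ => 1, Real.log, fun _ => 1, fun r => r]) fun i j => by
      have := sub_le_mul_log_sub_log (hρ.eigenvalues_nonneg i) (hσ.eigenvalues_pos j)
      simp only [Fin.sum_univ_four, cons_val]
      linarith
  simp only [Fin.sum_univ_four, cons_val, hentropy, hneg, cfc_const_one ℝ ρ, cfc_const_one ℝ σ,
    cfc_id' ℝ σ, mul_one, one_mul, neg_mul, trace_neg, map_add, map_neg, RCLike.re_to_complex]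
    at hnonneg
  rw [relEntropyReal, matLog, matLog, mul_sub, trace_sub, Complex.sub_re]
  linarith

end RelEntropy

section Holevo

variable {d X : Type*} [Fintype X]

lemma mulVec_eq_zero_of_sum_mulVec_eq_zero {𝕜 : Type*} [RCLike 𝕜] [Fintype d]
    {M : X → Matrix d d 𝕜} (hM : ∀ x, (M x).PosSemidef) {v : d → 𝕜} (hv : (∑ x, M x) *ᵥ v = 0)
    (x : X) : M x *ᵥ v = 0 := by
  have hsum : ∑ y, star v ⬝ᵥ (M y *ᵥ v) = 0 := by
    rw [← dotProduct_sum, ← sum_mulVec, hv, dotProduct_zero]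
  have hx := (Finset.sum_eq_zero_iff_of_nonneg fun y _ => (hM y).dotProduct_mulVec_nonneg v).mp
    hsum x (Finset.mem_univ x)
  exact ((hM x).dotProduct_mulVec_zero_iff v).mp hx

lemma posSemidef_output {W : X → Matrix d d ℂ} (hW : ∀ x, (W x).PosSemidef) {P : X → ℝ}
    (hP : ∀ x, 0 ≤ P x) : (output W P).PosSemidef :=
  posSemidef_sum _ fun x _ => (hW x).smul (hP x)

variable [Fintype d]

lemma mulVec_eq_zero_of_output_mulVec_eq_zero {W : X → Matrix d d ℂ}
    (hW : ∀ x, (W x).PosSemidef) {P : X → ℝ} (hP : ∀ x, 0 ≤ P x) {x : X} (hx : P x ≠ 0)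
    {v : d → ℂ} (hv : output W P *ᵥ v = 0) : W x *ᵥ v = 0 := by
  have h := mulVec_eq_zero_of_sum_mulVec_eq_zero (fun y => (hW y).smul (hP y)) hv x
  rw [smul_mulVec] at h
  exact (smul_eq_zero.mp h).resolve_left hx

lemma re_trace_output_mul (W : X → Matrix d d ℂ) (P : X → ℝ) (M : Matrix d d ℂ) :
    (output W P * M).trace.re = ∑ x, P x * (W x * M).trace.re := by
  simp [output, Finset.sum_mul, trace_sum, trace_smul]

lemma trace_output {W : X → Matrix d d ℂ} (hW : ∀ x, (W x).trace = 1) (P : X → ℝ) :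
    (output W P).trace = ((∑ x, P x : ℝ) : ℂ) := by
  simp [output, trace_sum, trace_smul, hW]

variable [DecidableEq d]

lemma sum_mul_relEntropyReal (W : X → Matrix d d ℂ) (P : X → ℝ) (σ : Matrix d d ℂ) :
    ∑ x, P x * relEntropyReal (W x) σ =
      ∑ x, P x * relEntropyReal (W x) (output W P) + relEntropyReal (output W P) σ := by
  simp only [relEntropyReal, re_trace_output_mul, ← Finset.sum_add_distrib, ← mul_add,
    ← Complex.add_re, ← trace_add, sub_add_sub_cancel]

lemma coe_sum (f : X → ℝ) : ((∑ x, f x : ℝ) : EReal) = ∑ x, (f x : EReal) :=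
  map_sum (⟨⟨Real.toEReal, EReal.coe_zero⟩, EReal.coe_add⟩ : ℝ →+ EReal) f Finset.univ

lemma holevoInformation_eq_coe_sum {W : X → Matrix d d ℂ} (hW : ∀ x, (W x).PosSemidef)
    {P : X → ℝ} (hP : ∀ x, 0 ≤ P x) :
    holevoInformation W P = ((∑ x, P x * relEntropyReal (W x) (output W P) : ℝ) : EReal) := by
  rw [holevoInformation, coe_sum]
  refine Finset.sum_congr rfl fun x _ => ?_
  rw [EReal.coe_mul]
  by_cases hx : P x = 0
  · simp only [hx, EReal.coe_zero, zero_mul]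
  · rw [relEntropy_of_ker_le fun v => mulVec_eq_zero_of_output_mulVec_eq_zero hW hP hx]

lemma holevoInformation_eq_of_relEntropy_eq {W : X → Matrix d d ℂ} {P : X → ℝ}
    (hP : ∑ x, P x = 1) {C : ℝ} (hC : ∀ x, relEntropy (W x) (output W P) = (C : EReal)) :
    holevoInformation W P = (C : EReal) := by
  simp_rw [holevoInformation, hC, ← EReal.coe_mul, ← coe_sum]
  rw [← Finset.sum_mul, hP, one_mul]

lemma capacity_le_of_relEntropy_le {W : X → Matrix d d ℂ} (hW : ∀ x, IsDensityMatrix (W x))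
    {σ : Matrix d d ℂ} (hσ : σ.PosDef) (htr : σ.trace = 1) {C : ℝ}
    (hC : ∀ x, relEntropy (W x) σ ≤ (C : EReal)) : capacity W ≤ (C : EReal) := by
  simp only [relEntropy_of_posDef _ hσ, EReal.coe_le_coe_iff] at hC
  refine sSup_le ?_
  rintro _ ⟨P, hP, rfl⟩
  have hPSD := posSemidef_output (fun x => (hW x).1) hP.1
  have hklein : 0 ≤ relEntropyReal (output W P) σ := by
    simpa [trace_output (fun x => (hW x).2), hP.2, htr] using
      trace_sub_trace_le_relEntropyReal hPSD hσ
  rw [holevoInformation_eq_coe_sum (fun x => (hW x).1) hP.1, EReal.coe_le_coe_iff]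
  calc ∑ x, P x * relEntropyReal (W x) (output W P)
      ≤ ∑ x, P x * relEntropyReal (W x) σ := by
        rw [sum_mul_relEntropyReal W P σ]
        exact le_add_of_nonneg_right hklein
    _ ≤ ∑ x, P x * C := Finset.sum_le_sum fun x _ => mul_le_mul_of_nonneg_left (hC x) (hP.1 x)
    _ = C := by rw [← Finset.sum_mul, hP.2, one_mul]

end Holevo

section Gibbs

variable {d J : Type*} [Fintype J] {A : J → Matrix d d ℂ}

lemma isHermitian_sum_smul (hA : ∀ j, (A j).IsHermitian) (θ : J → ℝ) :
    (∑ j, θ j • A j).IsHermitian :=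
  isSelfAdjoint_sum _ fun j _ => (hA j).smul (.all (θ j))

variable [Fintype d] [DecidableEq d]

lemma matLog_exp {H : Matrix d d ℂ} (hH : H.IsHermitian) : matLog (NormedSpace.exp H) = H := by
  open scoped Matrix.Norms.L2Operator in
  exact CFC.log_exp H hH

lemma posDef_exp {H : Matrix d d ℂ} (hH : H.IsHermitian) : (NormedSpace.exp H).PosDef := by
  have hnonneg : (NormedSpace.exp H).PosSemidef := by
    open scoped Matrix.Norms.L2Operator MatrixOrder in
    exact nonneg_iff_posSemidef.mp (IsSelfAdjoint.exp_nonneg (A := Matrix d d ℂ) hH)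
  exact hnonneg.posDef_iff_isUnit.mpr (isUnit_exp H)

lemma exp_sub_smul_one (H : Matrix d d ℂ) (r : ℝ) :
    NormedSpace.exp (H - r • (1 : Matrix d d ℂ)) = Real.exp (-r) • NormedSpace.exp H := by
  have hscalar : NormedSpace.exp (-r • (1 : Matrix d d ℂ)) = Real.exp (-r) • 1 := by
    open scoped Matrix.Norms.L2Operator in
    rw [Real.exp_eq_exp_ℝ, ← Algebra.algebraMap_eq_smul_one, ← Algebra.algebraMap_eq_smul_one,
      NormedSpace.algebraMap_exp_comm]
  rw [sub_eq_add_neg, ← neg_smul, exp_add_of_commute _ _ ((Commute.one_right H).smul_right _),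
    hscalar, mul_smul_comm, mul_one]

lemma isHermitian_gibbs_exponent (hA : ∀ j, (A j).IsHermitian) (θ : J → ℝ) :
    (∑ j, θ j • A j - phi A θ • (1 : Matrix d d ℂ)).IsHermitian :=
  (isHermitian_sum_smul hA θ).sub (isHermitian_one.smul (.all _))

lemma posDef_gibbs (hA : ∀ j, (A j).IsHermitian) (θ : J → ℝ) : (gibbs A θ).PosDef :=
  posDef_exp (isHermitian_gibbs_exponent hA θ)

lemma matLog_gibbs (hA : ∀ j, (A j).IsHermitian) (θ : J → ℝ) :
    matLog (gibbs A θ) = ∑ j, θ j • A j - phi A θ • (1 : Matrix d d ℂ) :=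
  matLog_exp (isHermitian_gibbs_exponent hA θ)

lemma trace_gibbs [Nonempty d] (hA : ∀ j, (A j).IsHermitian) (θ : J → ℝ) :
    (gibbs A θ).trace = 1 := by
  obtain ⟨hre, him⟩ := Complex.pos_iff.mp (posDef_exp (isHermitian_sum_smul hA θ)).trace_pos
  rw [gibbs, exp_sub_smul_one, trace_smul, Real.exp_neg, phi, Real.exp_log hre]
  apply Complex.ext
  · simp [inv_mul_cancel₀ hre.ne']
  · simp [← him]

lemma isDensityMatrix_gibbs [Nonempty d] (hA : ∀ j, (A j).IsHermitian) (θ : J → ℝ) :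
    IsDensityMatrix (gibbs A θ) :=
  ⟨(posDef_gibbs hA θ).posSemidef, trace_gibbs hA θ⟩

lemma relEntropy_gibbs {ρ : Matrix d d ℂ} (hρ : ρ.trace = 1) (hA : ∀ j, (A j).IsHermitian)
    (θ : J → ℝ) :
    relEntropy ρ (gibbs A θ) =
      ((phi A θ - entropy ρ - (∑ j, (ρ * A j).trace * (θ j : ℂ)).re : ℝ) : EReal) := by
  have hmoments : (ρ * ∑ j, θ j • A j).trace = ∑ j, (ρ * A j).trace * (θ j : ℂ) := by
    simp_rw [Finset.mul_sum, trace_sum, mul_smul_comm, trace_smul, Complex.real_smul, mul_comm]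
  rw [relEntropy_of_posDef _ (posDef_gibbs hA θ), relEntropyReal, matLog_gibbs hA, mul_sub,
    mul_sub, trace_sub, trace_sub, hmoments, mul_smul_comm, mul_one, trace_smul, hρ, entropy]
  simp only [Complex.sub_re, Complex.real_smul, mul_one, Complex.ofReal_re]
  congr 1
  ring

end Gibbs

end CQ

theorem theorem5_general {d X J : Type*} [Fintype d] [DecidableEq d] [Nonempty d] [Fintype X]
    [Fintype J] (hcard : Fintype.card X = Fintype.card d ^ 2)
    (W : X → Matrix d d ℂ) (hW : ∀ x, CQ.IsDensityMatrix (W x)) (hWind : LinearIndependent ℝ W)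
    (A : J → Matrix d d ℂ) (hA : ∀ j, (A j).IsHermitian) (θ : J → ℝ) (H₀ : ℝ)
    (hθ : ∀ i, ∑ j, (W i * A j).trace * (θ j : ℂ) = ((-CQ.entropy (W i) + H₀ : ℝ) : ℂ)) :
    CQ.IsDensityMatrix (CQ.gibbs A θ) ∧
    (∀ x, CQ.relEntropy (W x) (CQ.gibbs A θ) = ((CQ.phi A θ - H₀ : ℝ) : EReal)) ∧
    ∃ Q : X → ℝ,
      (∀ Q' : X → ℝ, CQ.output W Q' = CQ.gibbs A θ ↔ Q' = Q) ∧
      ((∀ x, 0 ≤ Q x) →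
        Q ∈ stdSimplex ℝ X ∧
        CQ.holevoInformation W Q = CQ.capacity W ∧
        CQ.capacity W = ((CQ.phi A θ - H₀ : ℝ) : EReal)) := by
  have hρ := CQ.isDensityMatrix_gibbs hA θ
  have hD (x : X) : CQ.relEntropy (W x) (CQ.gibbs A θ) = ((CQ.phi A θ - H₀ : ℝ) : EReal) := by
    rw [CQ.relEntropy_gibbs (hW x).2 hA, hθ x, Complex.ofReal_re, sub_sub, add_neg_cancel_left]
  obtain ⟨Q, hQ, huniq⟩ := CQ.existsUnique_sum_smul_eq_of_isSelfAdjoint (fun x => (hW x).1.1) hWind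
    (by rw [hcard, Module.finrank_matrix, Module.finrank_self, mul_one, sq]) hρ.1.1
  refine ⟨hρ, hD, Q, fun Q' => ⟨huniq Q', fun hQ' => hQ' ▸ hQ⟩, fun hQ0 => ?_⟩
  change CQ.output W Q = CQ.gibbs A θ at hQ
  have hsum : ∑ x, Q x = 1 := by
    exact_mod_cast (CQ.trace_output (fun x => (hW x).2) Q).symm.trans (hQ ▸ hρ.2)
  have hI := CQ.holevoInformation_eq_of_relEntropy_eq hsum (hQ ▸ hD)
  have hcap : CQ.capacity W = ((CQ.phi A θ - H₀ : ℝ) : EReal) :=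
    le_antisymm (CQ.capacity_le_of_relEntropy_le hW (CQ.posDef_gibbs hA θ) hρ.2 fun x => (hD x).le)
      (hI ▸ le_sSup ⟨Q, ⟨hQ0, hsum⟩, rfl⟩)
  exact ⟨⟨hQ0, hsum⟩, hI.trans hcap.symm, hcap⟩

theorem theorem5 (n : ℕ) (hn : 0 < n)
    (W : Fin (n ^ 2) → Matrix (Fin n) (Fin n) ℂ)
    (hW : ∀ x, CQ.IsDensityMatrix (W x))
    (hWind : LinearIndependent ℝ W)
    (A : Fin (n ^ 2 - 1) → Matrix (Fin n) (Fin n) ℂ)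
    (hA : ∀ j, (A j).IsHermitian)
    (hAind : LinearIndependent ℝ A)
    (hA0 : ∀ j, (W (CQ.lastInput n hn) * A j).trace = 0)
    (θ : Fin (n ^ 2 - 1) → ℝ)
    (hθ : ∀ i, ∑ j, (W i * A j).trace * (θ j : ℂ) =
      ((-CQ.entropy (W i) + CQ.entropy (W (CQ.lastInput n hn)) : ℝ) : ℂ)) :
    CQ.IsDensityMatrix (CQ.gibbs A θ) ∧
    (∀ x, CQ.relEntropy (W x) (CQ.gibbs A θ) =
      ((CQ.phi A θ - CQ.entropy (W (CQ.lastInput n hn)) : ℝ) : EReal)) ∧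
    ∃ Q : Fin (n ^ 2) → ℝ,
      (∀ Q' : Fin (n ^ 2) → ℝ, CQ.output W Q' = CQ.gibbs A θ ↔ Q' = Q) ∧
      ((∀ x, 0 ≤ Q x) →
        Q ∈ stdSimplex ℝ (Fin (n ^ 2)) ∧
        CQ.holevoInformation W Q = CQ.capacity W ∧
        CQ.capacity W =
          ((CQ.phi A θ - CQ.entropy (W (CQ.lastInput n hn)) : ℝ) : EReal)) := by
  have : Nonempty (Fin n) := Fin.pos_iff_nonempty.mp hn
  exact theorem5_general (by simp) W hW hWind A hA θ _ hθ
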